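/- Let $Q\in\mathbb R^{d\times d}$ be substochastic (nonnegative entries, row sums at most $1$), $R=I-Q^{T}$, $\mu\in\mathbb R^d$, $C\in\mathbb R^{d\times d}$ and $\Sigma=CC^{T}$, and suppose that for constants $\kappa_0,b_0,\delta_0>0$ and $\beta_0\in(0,1)$ $$\|\mathbf 1^{T}Q^{n}\|_\infty\le\kappa_0(1-\beta_0)^{n}\ (n\ge 0),\qquad R^{-1}\mu<-\delta_0\mathbf 1,\qquad b_0^{-1}\le\Sigma_{ii}\le b_0\ (1\le i\le d),$$ where $\|v\|_\infty=\max_i|v_i|$ for row and column vectors. A pair $(Y,L)$ solves the Skorokhod problem with input $X$ and reflection matrix $R$ if $0\le Y(t)=Y(0)+X(t)+RL(t)$ for all $t\ge0$, $L(0)=0$, each $L_i$ is nondecreasing and right-continuous, and $\int_{(0,t]}Y_i\,dL_i=0$ for all $i$ and $t$. Let $B$ be a standard $d$-dimensional Brownian motion and $X(t)=\mu t+CB(t)$. For $\gamma\in(0,1)$ and an integer $m\ge0$ let $B^m$ be the piecewise-linear interpolation of $B$ on the grid $\{0,\gamma^m,2\gamma^m,\dots\}$ and $X^m(t)=\mu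 t+CB^m(t)$. Let $Y$ and $Y^m$ be stochastic processes with the same (possibly random) initial value $Y^m(0)=Y(0)$ a.s. that almost surely solve the Skorokhod problem with reflection matrix $R$ and input $X$, respectively $X^m$; so $Y$ is a $(\mu,\Sigma,R)$-reflected Brownian motion. Lemma. For every $\eta>0$ there is a constant $C_1>0$ depending only on $\kappa_0,\beta_0,b_0$ and $\eta$ (hence not on $d,t,m,\gamma,\delta_0,\mu,C,Q$) such that for all $d\ge1$, $\gamma\in(0,1)$, $m\ge0$ and $t>0$ with $\log t+\log d+m\log(1/\gamma)\ge\eta$, the random variable $\|Y^m(t)-Y(t)\|_\infty^2$ is integrable and $$E\big[\|Y^m(t)-Y(t)\|_\infty^2\big]\le C_1\,\gamma^m\big(\log t+\log d+m\log(1/\gamma)\big).$$ -/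

import Mathlib

open MeasureTheory ProbabilityTheory
open scoped NNReal ENNReal Matrix

namespace RBM

/-- Vectors are functions `Fin d → ℝ`, whose Mathlib norm is the `ℓ^∞` norm.
`IsStandardBM B P`: the components of `B` are independent standard real Brownian motions
(started at `0`, with almost surely continuous paths). -/
structure IsStandardBM {Ω : Type*} [MeasurableSpace Ω] {d : ℕ}
    (B : ℝ≥0 → Ω → Fin d → ℝ) (P : Measure Ω) : Prop where
  brownian : ∀ i, IsBrownianReal (fun t ω => B t ω i) P
  indep : iIndepFun (fun i ω (t : ℝ≥0) => B t ω i) P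

/-- The grid `{0, h, 2h, …}`. -/
def grid (h : ℝ≥0) : Set ℝ≥0 := {r | ∃ k : ℕ, r = k * h}

/-- The last grid point `≤ t`. -/
noncomputable def gridBelow (h t : ℝ≥0) : ℝ≥0 := sSup {r | r ∈ grid h ∧ r ≤ t}

/-- The first grid point `> t`. -/
noncomputable def gridAbove (h t : ℝ≥0) : ℝ≥0 := sInf {r | r ∈ grid h ∧ t < r}

/-- Piecewise-linear interpolation of the path `b` on the grid of step `h`. -/
noncomputable def interpolate {d : ℕ} (h : ℝ≥0) (b : ℝ≥0 → Fin d → ℝ) (t : ℝ≥0) : Fin d → ℝ :=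
  b (gridBelow h t) +
    (((t : ℝ) - gridBelow h t) / ((gridAbove h t : ℝ) - gridBelow h t)) •
      (b (gridAbove h t) - b (gridBelow h t))

/-- The input path `X(t) = μ t + C b(t)`. -/
def drivingPath {d : ℕ} (μ : Fin d → ℝ) (C : Matrix (Fin d) (Fin d) ℝ)
    (b : ℝ≥0 → Fin d → ℝ) (t : ℝ≥0) : Fin d → ℝ :=
  (t : ℝ) • μ + C *ᵥ b t

/-- The path pair `(y, l)` solves the Skorokhod problem with input path `x` and reflection
matrix `R`: `0 ≤ y(t) = y(0) + x(t) + R l(t)`, `l(0) = 0`, every `l_i` is nondecreasing (and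
right-continuous, so that the Lebesgue–Stieltjes measure `dl_i` makes sense) and
`∫_{(0,t]} y_i dl_i = 0`. -/
structure SolvesSkorokhod {d : ℕ} (R : Matrix (Fin d) (Fin d) ℝ)
    (x y l : ℝ≥0 → Fin d → ℝ) : Prop where
  nonneg : ∀ t i, 0 ≤ y t i
  eq : ∀ t, y t = y 0 + x t + R *ᵥ l t
  l_zero : l 0 = 0
  mono : ∀ i, Monotone fun s => l s i
  rightCont : ∀ i s, ContinuousWithinAt (fun s => l s i) (Set.Ici s) s
  compl : ∀ i t, ∫⁻ s in Set.Ioc 0 t, ENNReal.ofReal (y s i)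
    ∂(StieltjesFunction.mk (fun s => l s i) (mono i) (rightCont i)).measure = 0

/-- `Y` is the reflected process driven by the process `X`: a stochastic process which, along
almost every sample path, is the `y`-component of a solution of the Skorokhod problem. -/
structure IsReflectedProcess {Ω : Type*} [MeasurableSpace Ω] {d : ℕ} (P : Measure Ω)
    (R : Matrix (Fin d) (Fin d) ℝ) (X Y : ℝ≥0 → Ω → Fin d → ℝ) : Prop where
  aemeasurable : ∀ t, AEMeasurable (Y t) P
  solves : ∀ᵐ ω ∂P, ∃ l : ℝ≥0 → Fin d → ℝ,
    SolvesSkorokhod R (fun t => X t ω) (fun t => Y t ω) l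

/-- The reflection matrix `R = I - Qᵀ`. -/
def reflectionMatrix {d : ℕ} (Q : Matrix (Fin d) (Fin d) ℝ) : Matrix (Fin d) (Fin d) ℝ :=
  1 - Qᵀ

/-- The uniformity conditions on the parameters `(μ, Σ = C Cᵀ, R = I - Qᵀ)`, with `Q`
substochastic: uniform contraction, uniform stability and uniform marginal variability. -/
structure UniformAssumptions {d : ℕ} (κ₀ β₀ δ₀ b₀ : ℝ) (μ : Fin d → ℝ)
    (C Q : Matrix (Fin d) (Fin d) ℝ) : Prop where
  Q_nonneg : ∀ i j, 0 ≤ Q i j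
  Q_rowSum : ∀ i, ∑ j, Q i j ≤ 1
  contraction : ∀ n : ℕ, ‖(1 : Fin d → ℝ) ᵥ* (Q ^ n)‖ ≤ κ₀ * (1 - β₀) ^ n
  stability : ∀ i, ((reflectionMatrix Q)⁻¹ *ᵥ μ) i < -δ₀
  variability : ∀ i, b₀⁻¹ ≤ (C * Cᵀ) i i ∧ (C * Cᵀ) i i ≤ b₀

end RBM

namespace RBM

/-! The Skorokhod map is Lipschitz in the uniform norm with a constant depending only on `κ₀` and
`β₀` (`abs_reflected_sub_le`): differences of regulators satisfy a Picard inequality driven by `Qᵀ`,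
and iterating it gives a Neumann series that the contraction hypothesis bounds by `κ₀ / β₀`. The
drift cancels, so only the uniform error of interpolating `C B` on `[0, t]` remains.

That error is controlled by dyadic chaining. With `h = γ ^ m` and about `t / h` cells, level `n`
involves about `d (t / h) 2 ^ n` Gaussian increments of variance at most `b₀ h / 2 ^ n`. Whatever
their dependence, their maximal square has mean of order `h 2⁻ⁿ (log d + log (t / h) + n + 1)`
(`lintegral_iSup_sq_gaussian_le`). A weighted Cauchy–Schwarz inequality assembles the levels at the
price of a factor `(4 / 3) ^ n`, which `2⁻ⁿ` absorbs (`lintegral_sqOscBound_le`). Since `log (t / h)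
= log t + m log (1 / γ)`, this is the claimed rate up to an additive constant, absorbed using the
lower bound `η`. Times shorter than one cell need a separate estimate
(`exists_interpolate_error_bound`). -/

/-! ### Lipschitz continuity of the Skorokhod map -/

/-- Where `l > M` the process `y` is positive, so complementarity forbids `dl` from charging that
set: `l` can neither jump across `M` nor grow above it. -/
theorem regulator_le {y l : ℝ≥0 → ℝ} (mono : Monotone l)
    (rc : ∀ s, ContinuousWithinAt l (Set.Ici s) s) (l0 : l 0 = 0) {t : ℝ≥0}
    (compl : ∫⁻ s in Set.Ioc 0 t, ENNReal.ofReal (y s)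
      ∂(StieltjesFunction.mk l mono rc).measure = 0)
    {M : ℝ} (hM : 0 ≤ M) (h : ∀ s ≤ t, l s - M ≤ y s) : l t ≤ M := by
  by_contra! hlt
  set ν := (StieltjesFunction.mk l mono rc).measure with hν
  have h1 : ∫⁻ s in Set.Ioc 0 t, ENNReal.ofReal (l s - M) ∂ν = 0 := by
    refine le_antisymm (le_trans ?_ compl.le) zero_le
    exact setLIntegral_mono' measurableSet_Ioc
      fun s hs => ENNReal.ofReal_le_ofReal (h s hs.2)
  have hmeas : Measurable fun s => ENNReal.ofReal (l s - M) :=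
    (mono.measurable.sub_const M).ennreal_ofReal
  rw [lintegral_eq_zero_iff hmeas, Filter.EventuallyEq, ae_restrict_iff' measurableSet_Ioc,
    ae_iff] at h1
  have hnull : ∀ A : Set ℝ≥0, (∀ s ∈ A, s ∈ Set.Ioc 0 t ∧ M < l s) → ν A = 0 := by
    intro A hA
    refine measure_mono_null (fun s hs => ?_) h1
    obtain ⟨h2, h3⟩ := hA s hs
    simp only [Pi.zero_apply, ENNReal.ofReal_eq_zero, Set.mem_ofPred_eq]
    intro h4
    linarith [h4 h2]
  set τ := sInf {s | M < l s} with hτ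
  have hne : t ∈ {s | M < l s} := hlt
  have hτt : τ ≤ t := csInf_le (OrderBot.bddBelow _) hne
  have hgt : ∀ s, τ < s → M < l s := by
    intro s hs
    obtain ⟨u, hu, hus⟩ := exists_lt_of_csInf_lt ⟨t, hne⟩ hs
    exact lt_of_lt_of_le hu (mono hus.le)
  have hle : ∀ s, s < τ → l s ≤ M := by
    intro s hs
    by_contra! h2
    have h3 : τ ≤ s := csInf_le (OrderBot.bddBelow _) (show s ∈ {s | M < l s} from h2)
    exact absurd h3 (not_le.2 hs)
  have h2 := hnull (Set.Ioc τ t) fun s hs =>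
    ⟨⟨lt_of_le_of_lt zero_le hs.1, hs.2⟩, hgt s hs.1⟩
  rw [hν, StieltjesFunction.measure_Ioc, ENNReal.ofReal_eq_zero] at h2
  have h3 : l t ≤ l τ := by
    have : l t - l τ ≤ 0 := h2
    linarith
  have hMτ : M < l τ := hlt.trans_le h3
  -- Complementarity only covers `(0, t]`, and the left limit at `τ` needs earlier times; `l 0 = 0`
  -- excludes `τ = 0`.
  have hτ0 : 0 < τ := by
    rcases eq_zero_or_pos τ with h0 | h0
    · rw [h0, l0] at hMτ; linarith
    · exact h0
  have h4 := hnull {τ} (by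
    rintro s rfl
    exact ⟨⟨hτ0, hτt⟩, hMτ⟩)
  rw [hν, StieltjesFunction.measure_singleton, ENNReal.ofReal_eq_zero] at h4
  have h5 : Function.leftLim l τ ≤ M := by
    have : (nhdsWithin τ (Set.Iio τ)).NeBot := nhdsLT_neBot_of_exists_lt ⟨0, hτ0⟩
    exact le_of_tendsto (mono.tendsto_leftLim τ)
      (Filter.eventually_of_mem self_mem_nhdsWithin hle)
  have h6 : l τ - Function.leftLim l τ ≤ 0 := h4
  linarith

/-- One Picard step. For `r ≤ s`, comparing the two equations and using `y' ≥ 0` and `l' r ≤ l' s`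
yields `y r i ≥ l r i - M` with `M = l' s i + ξ i + (Qᵀ v) i`, so `regulator_le` applies; exchanging
the two solutions gives the absolute value. -/
theorem abs_regulator_sub_le {d : ℕ} {Q : Matrix (Fin d) (Fin d) ℝ} (hQ : ∀ i j, 0 ≤ Q i j)
    {x x' y y' l l' : ℝ≥0 → Fin d → ℝ}
    (h : SolvesSkorokhod (reflectionMatrix Q) x y l)
    (h' : SolvesSkorokhod (reflectionMatrix Q) x' y' l') (h0 : y 0 = y' 0) {t : ℝ≥0}
    {ξ v : Fin d → ℝ} (hx : ∀ s ≤ t, ∀ i, |x s i - x' s i| ≤ ξ i)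
    (hl : ∀ s ≤ t, ∀ i, |l s i - l' s i| ≤ v i) :
    ∀ s ≤ t, ∀ i, |l s i - l' s i| ≤ ξ i + (Qᵀ *ᵥ v) i := by
  have key : ∀ {x x' y y' l l' : ℝ≥0 → Fin d → ℝ},
      SolvesSkorokhod (reflectionMatrix Q) x y l →
      SolvesSkorokhod (reflectionMatrix Q) x' y' l' → y 0 = y' 0 →
      (∀ s ≤ t, ∀ i, |x s i - x' s i| ≤ ξ i) → (∀ s ≤ t, ∀ i, |l s i - l' s i| ≤ v i) →
      ∀ s ≤ t, ∀ i, l s i - l' s i ≤ ξ i + (Qᵀ *ᵥ v) i := by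
    intro x x' y y' l l' h h' h0 hx hl s hs i
    have hD : ∀ r ≤ t, |(Qᵀ *ᵥ l r) i - (Qᵀ *ᵥ l' r) i| ≤ (Qᵀ *ᵥ v) i := by
      intro r hr
      simp only [Matrix.mulVec, dotProduct, ← Finset.sum_sub_distrib, ← mul_sub]
      refine (Finset.abs_sum_le_sum_abs _ _).trans (Finset.sum_le_sum fun j _ => ?_)
      rw [Matrix.transpose_apply, abs_mul, abs_of_nonneg (hQ j i)]
      exact mul_le_mul_of_nonneg_left (hl r hr j) (hQ j i)
    have hξ : 0 ≤ ξ i := (abs_nonneg _).trans (hx s hs i)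
    have hQv : 0 ≤ (Qᵀ *ᵥ v) i := (abs_nonneg _).trans (hD s hs)
    have hl's : 0 ≤ l' s i := by
      have := h'.mono i (zero_le (a := s))
      simpa [h'.l_zero] using this
    have := regulator_le (h.mono i) (h.rightCont i) (by simp [h.l_zero]) (h.compl i s)
      (M := l' s i + (ξ i + (Qᵀ *ᵥ v) i)) (by positivity) (by
        intro r hr
        have e1 := congrFun (h.eq r) i
        have e2 := congrFun (h'.eq r) i
        have n2 := h'.nonneg r i
        have m2 : l' r i ≤ l' s i := h'.mono i hr
        have b1 := abs_le.1 (hx r (hr.trans hs) i)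
        have b2 := abs_le.1 (hD r (hr.trans hs))
        have h00 := congrFun h0 i
        simp only [reflectionMatrix, Matrix.sub_mulVec, Matrix.one_mulVec, Pi.add_apply,
          Pi.sub_apply] at e1 e2
        linarith [b1.1, b2.2])
    linarith
  intro s hs i
  rw [abs_le']
  refine ⟨key h h' h0 hx hl s hs i, ?_⟩
  have := key h' h h0.symm (fun r hr j => by rw [abs_sub_comm]; exact hx r hr j)
    (fun r hr j => by rw [abs_sub_comm]; exact hl r hr j) s hs i
  linarith

/-- The row vector `1ᵀ Qⁿ` lists the column sums of `Qⁿ`, which are the row sums of `(Qᵀ)ⁿ`. -/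
theorem mulVec_transpose_pow_le {d : ℕ} {Q : Matrix (Fin d) (Fin d) ℝ} {a c : ℝ} (n : ℕ)
    (hQ : ∀ i j, 0 ≤ (Q ^ n) i j) (ha : ‖(1 : Fin d → ℝ) ᵥ* (Q ^ n)‖ ≤ a) (hc : 0 ≤ c)
    {v : Fin d → ℝ} (hv : ∀ i, v i ≤ c) (i : Fin d) : ((Qᵀ ^ n) *ᵥ v) i ≤ a * c := by
  have h1 : ((1 : Fin d → ℝ) ᵥ* (Q ^ n)) i ≤ a :=
    (le_abs_self _).trans ((norm_le_pi_norm _ i).trans ha)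
  refine le_trans ?_ (mul_le_mul_of_nonneg_right h1 hc)
  rw [← Matrix.transpose_pow]
  simp only [Matrix.mulVec, Matrix.vecMul, dotProduct, Finset.sum_mul, Matrix.transpose_apply,
    Pi.one_apply, one_mul]
  exact Finset.sum_le_sum fun j _ => mul_le_mul_of_nonneg_left (hv j) (hQ j i)

theorem pow_apply_nonneg {d : ℕ} {Q : Matrix (Fin d) (Fin d) ℝ} (hQ : ∀ i j, 0 ≤ Q i j) (n : ℕ) :
    ∀ i j, 0 ≤ (Q ^ n) i j := by
  induction n with
  | zero => intro i j; simp only [pow_zero, Matrix.one_apply]; split <;> norm_num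
  | succ n ih =>
    intro i j
    rw [pow_succ, Matrix.mul_apply]
    exact Finset.sum_nonneg fun k _ => mul_nonneg (ih i k) (hQ k j)

theorem abs_regulator_sub_le_const {d : ℕ} {Q : Matrix (Fin d) (Fin d) ℝ} {κ β : ℝ}
    (hβ : β ∈ Set.Ioo (0 : ℝ) 1) (hκ : 0 < κ) (hQ : ∀ i j, 0 ≤ Q i j)
    (hc : ∀ n : ℕ, ‖(1 : Fin d → ℝ) ᵥ* (Q ^ n)‖ ≤ κ * (1 - β) ^ n)
    {x x' y y' l l' : ℝ≥0 → Fin d → ℝ}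
    (h : SolvesSkorokhod (reflectionMatrix Q) x y l)
    (h' : SolvesSkorokhod (reflectionMatrix Q) x' y' l') (h0 : y 0 = y' 0) {t : ℝ≥0}
    {ξ : ℝ} (hξ : 0 ≤ ξ) (hx : ∀ s ≤ t, ∀ i, |x s i - x' s i| ≤ ξ) (i : Fin d) :
    |l t i - l' t i| ≤ κ / β * ξ := by
  -- A crude a priori bound, valid by monotonicity, starts the iteration; its contribution `(Qᵀ)ⁿ v`
  -- vanishes in the limit.
  set v : Fin d → ℝ := fun i => l t i + l' t i with hv
  have hb : ∀ n : ℕ, ∀ s ≤ t, ∀ i, |l s i - l' s i| ≤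
      (∑ k ∈ Finset.range n, ((Qᵀ ^ k) *ᵥ fun _ => ξ) + (Qᵀ ^ n) *ᵥ v) i := by
    intro n
    induction n with
    | zero =>
      intro s hs i
      have a1 : l s i ≤ l t i := h.mono i hs
      have a2 : l' s i ≤ l' t i := h'.mono i hs
      have a3 := h.mono i (zero_le (a := s))
      have a4 := h'.mono i (zero_le (a := s))
      simp only [h.l_zero, h'.l_zero, Pi.zero_apply] at a3 a4
      simp only [Finset.range_zero, Finset.sum_empty, pow_zero, Matrix.one_mulVec, zero_add, hv]
      rw [abs_le]; constructor <;> linarith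
    | succ n ih =>
      intro s hs i
      refine (abs_regulator_sub_le hQ h h' h0 (ξ := fun _ => ξ) hx ih s hs i).trans (le_of_eq ?_)
      rw [Finset.sum_range_succ', Matrix.mulVec_add, Matrix.mulVec_mulVec, ← pow_succ',
        Matrix.mulVec_sum]
      simp only [Matrix.mulVec_mulVec, ← pow_succ', Pi.add_apply, pow_zero, Matrix.one_mulVec]
      ring
  obtain ⟨c, hc0, hvc⟩ : ∃ c, 0 ≤ c ∧ ∀ i, v i ≤ c :=
    ⟨‖v‖, norm_nonneg _, fun i => (le_abs_self _).trans (norm_le_pi_norm v i)⟩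
  have hfin : ∀ n : ℕ, |l t i - l' t i| ≤ κ / β * ξ + κ * (1 - β) ^ n * c := by
    intro n
    refine (hb n t le_rfl i).trans ?_
    rw [Pi.add_apply, Finset.sum_apply]
    refine add_le_add ?_ (mulVec_transpose_pow_le n (pow_apply_nonneg hQ n) (hc n) hc0 hvc i)
    calc ∑ k ∈ Finset.range n, ((Qᵀ ^ k) *ᵥ fun _ => ξ) i
        ≤ ∑ k ∈ Finset.range n, κ * (1 - β) ^ k * ξ := Finset.sum_le_sum fun k _ =>
          mulVec_transpose_pow_le k (pow_apply_nonneg hQ k) (hc k) hξ (fun _ => le_rfl) i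
      _ = κ * (∑ k ∈ Finset.range n, (1 - β) ^ k) * ξ := by rw [Finset.mul_sum, Finset.sum_mul]
      _ ≤ κ * β⁻¹ * ξ := by
          have h1 : ∑ k ∈ Finset.range n, (1 - β) ^ k ≤ β⁻¹ := by
            have := Summable.sum_le_tsum (Finset.range n)
              (fun k _ => pow_nonneg (by linarith [hβ.2] : 0 ≤ 1 - β) k)
              (summable_geometric_of_lt_one (by linarith [hβ.2]) (by linarith [hβ.1]))
            rw [tsum_geometric_of_lt_one (by linarith [hβ.2]) (by linarith [hβ.1])] at this
            simpa using this
          gcongr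
      _ = κ / β * ξ := by rw [div_eq_mul_inv]
  have hlim : Filter.Tendsto (fun n : ℕ => κ / β * ξ + κ * (1 - β) ^ n * c) Filter.atTop
      (nhds (κ / β * ξ + κ * 0 * c)) :=
    (((tendsto_pow_atTop_nhds_zero_of_lt_one (by linarith [hβ.2]) (by linarith [hβ.1])).const_mul
      κ).mul_const c).const_add _
  have := ge_of_tendsto' hlim hfin
  simpa using this

/-- Lipschitz continuity of the Skorokhod map in the supremum norm. -/
theorem abs_reflected_sub_le {d : ℕ} {Q : Matrix (Fin d) (Fin d) ℝ} {κ β : ℝ}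
    (hβ : β ∈ Set.Ioo (0 : ℝ) 1) (hκ : 0 < κ) (hQ : ∀ i j, 0 ≤ Q i j)
    (hc : ∀ n : ℕ, ‖(1 : Fin d → ℝ) ᵥ* (Q ^ n)‖ ≤ κ * (1 - β) ^ n)
    {x x' y y' l l' : ℝ≥0 → Fin d → ℝ}
    (h : SolvesSkorokhod (reflectionMatrix Q) x y l)
    (h' : SolvesSkorokhod (reflectionMatrix Q) x' y' l') (h0 : y 0 = y' 0) {t : ℝ≥0}
    {ξ : ℝ} (hξ : 0 ≤ ξ) (hx : ∀ s ≤ t, ∀ i, |x s i - x' s i| ≤ ξ) (i : Fin d) :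
    |y t i - y' t i| ≤ (1 + (1 + κ) * (κ / β)) * ξ := by
  have hl := abs_regulator_sub_le_const hβ hκ hQ hc h h' h0 hξ hx
  have hw : 0 ≤ κ / β * ξ := mul_nonneg (div_nonneg hκ.le hβ.1.le) hξ
  have h1 := mulVec_transpose_pow_le 1 (pow_apply_nonneg hQ 1) (hc 1) hw
    (v := fun j => |l t j - l' t j|) hl i
  have h2 : |(Qᵀ *ᵥ l t) i - (Qᵀ *ᵥ l' t) i| ≤ (Qᵀ *ᵥ fun j => |l t j - l' t j|) i := by
    simp only [Matrix.mulVec, dotProduct, ← Finset.sum_sub_distrib, ← mul_sub]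
    refine (Finset.abs_sum_le_sum_abs _ _).trans (Finset.sum_le_sum fun j _ => ?_)
    rw [Matrix.transpose_apply, abs_mul, abs_of_nonneg (hQ j i)]
  have h3 : κ * (1 - β) ^ 1 * (κ / β * ξ) ≤ κ * (κ / β * ξ) := by
    apply mul_le_mul_of_nonneg_right _ hw
    nlinarith [hβ.1]
  rw [pow_one] at h1
  have e1 := congrFun (h.eq t) i
  have e2 := congrFun (h'.eq t) i
  have h00 := congrFun h0 i
  simp only [reflectionMatrix, Matrix.sub_mulVec, Matrix.one_mulVec, Pi.add_apply,
    Pi.sub_apply] at e1 e2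
  have b1 := abs_le.1 (hx t le_rfl i)
  have b2 := abs_le.1 (h2.trans (h1.trans h3))
  have b3 := abs_le.1 (hl i)
  rw [abs_le]
  constructor
  · linarith [b1.1, b2.2, b3.1]
  · linarith [b1.2, b2.1, b3.2]

/-! ### Maxima of Gaussian variables -/

theorem lintegral_exp_sq_div_gaussianReal_le {v : ℝ≥0} {V : ℝ} (hV : 0 < V) (hv : v ≤ V) :
    ∫⁻ x, ENNReal.ofReal (Real.exp (x ^ 2 / (4 * V))) ∂(gaussianReal 0 v) ≤ 2 := by
  -- Scaling from the standard Gaussian includes `v = 0`, where there is no density.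
  have hmap : gaussianReal 0 v = (gaussianReal 0 1).map (fun x => √v * x) := by
    rw [gaussianReal_map_const_mul]
    congr 1
    · simp
    · ext; simp
  rw [hmap, lintegral_map (by fun_prop) (by fun_prop)]
  have hle : ∀ x : ℝ, (√v * x) ^ 2 / (4 * V) ≤ x ^ 2 / 4 := by
    intro x
    rw [mul_pow, Real.sq_sqrt v.coe_nonneg, div_le_div_iff₀ (by positivity) (by norm_num)]
    nlinarith [sq_nonneg x, mul_le_mul_of_nonneg_right hv (sq_nonneg x)]
  calc ∫⁻ x, ENNReal.ofReal (Real.exp ((√v * x) ^ 2 / (4 * V))) ∂(gaussianReal 0 1)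
      ≤ ∫⁻ x, ENNReal.ofReal (Real.exp (x ^ 2 / 4)) ∂(gaussianReal 0 1) :=
        lintegral_mono fun x => ENNReal.ofReal_le_ofReal (Real.exp_le_exp.2 (hle x))
    _ = ∫⁻ x, ENNReal.ofReal ((√(2 * Real.pi))⁻¹ * Real.exp (-(1 / 4) * x ^ 2)) := by
        rw [gaussianReal_of_var_ne_zero _ one_ne_zero,
          lintegral_withDensity_eq_lintegral_mul _ (by fun_prop) (by fun_prop)]
        refine lintegral_congr fun x => ?_
        rw [Pi.mul_apply, gaussianPDF, ← ENNReal.ofReal_mul (gaussianPDFReal_nonneg _ _ _),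
          gaussianPDFReal, mul_assoc, ← Real.exp_add]
        simp only [NNReal.coe_one, mul_one, sub_zero]
        ring_nf
    _ = ENNReal.ofReal ((√(2 * Real.pi))⁻¹ * √(Real.pi / (1 / 4))) := by
        rw [← ofReal_integral_eq_lintegral_ofReal, integral_const_mul, integral_gaussian]
        · exact (integrable_exp_neg_mul_sq (by norm_num)).const_mul _
        · exact Filter.Eventually.of_forall fun x => by positivity
    _ ≤ ENNReal.ofReal 2 := by
        apply ENNReal.ofReal_le_ofReal
        rw [inv_mul_le_iff₀ (by positivity)]
        apply Real.sqrt_le_iff.2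
        refine ⟨by positivity, ?_⟩
        rw [mul_pow, Real.sq_sqrt (by positivity)]
        linarith [Real.pi_pos]
    _ = 2 := by simp

/-- Second moment of the maximum of finitely many centred Gaussian variables, which need not be
independent. -/
theorem lintegral_iSup_sq_gaussian_le {Ω : Type*} [MeasurableSpace Ω] {P : Measure Ω}
    [IsProbabilityMeasure P] {ι : Type*} [Fintype ι] [Nonempty ι] {G : ι → Ω → ℝ} {V : ℝ}
    (hV : 0 < V) (hG : ∀ i, ∃ v : ℝ≥0, (v : ℝ) ≤ V ∧ HasLaw (G i) (gaussianReal 0 v) P) :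
    ∫⁻ ω, ⨆ i, ENNReal.ofReal (G i ω ^ 2) ∂P ≤
      ENNReal.ofReal (4 * V * (Real.log (2 * Fintype.card ι) + 1)) := by
  set n : ℝ := ((Fintype.card ι : ℕ) : ℝ) with hn
  have hn1 : 1 ≤ n := by rw [hn]; exact_mod_cast Fintype.card_pos
  have hlog : 0 ≤ Real.log (2 * n) := Real.log_nonneg (by linarith)
  have hpt : ∀ ω, ⨆ i, ENNReal.ofReal (G i ω ^ 2) ≤
      ENNReal.ofReal (4 * V * Real.log (2 * n)) +
        ENNReal.ofReal (4 * V / (2 * n)) *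
          ∑ i, ENNReal.ofReal (Real.exp (G i ω ^ 2 / (4 * V))) := by
    intro ω
    refine iSup_le fun i => ?_
    set u := Real.exp (G i ω ^ 2 / (4 * V)) with hu
    have hu0 : 0 < u := Real.exp_pos _
    have h1 : G i ω ^ 2 ≤ 4 * V * Real.log (2 * n) + 4 * V / (2 * n) * u := by
      -- Linearising the logarithm at `2 n`, the bound on the mean of the sum of the exponentials,
      -- replaces the maximum by a sum at the cost of only `4 V` in the mean.
      have h2 : Real.log (u / (2 * n)) ≤ u / (2 * n) - 1 :=
        Real.log_le_sub_one_of_pos (by positivity)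
      rw [Real.log_div hu0.ne' (by positivity), hu, Real.log_exp, ← hu] at h2
      have h3 : G i ω ^ 2 / (4 * V) ≤ Real.log (2 * n) + u / (2 * n) := by linarith
      rw [div_le_iff₀ (by positivity)] at h3
      calc G i ω ^ 2 ≤ _ := h3
        _ = _ := by ring
    refine (ENNReal.ofReal_le_ofReal h1).trans ?_
    rw [ENNReal.ofReal_add (by positivity) (by positivity),
      ENNReal.ofReal_mul (p := 4 * V / (2 * n)) (by positivity)]
    gcongr
    exact Finset.single_le_sum (f := fun i => ENNReal.ofReal (Real.exp (G i ω ^ 2 / (4 * V))))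
      (fun _ _ => zero_le) (Finset.mem_univ i)
  have hexp : ∀ i, ∫⁻ ω, ENNReal.ofReal (Real.exp (G i ω ^ 2 / (4 * V))) ∂P ≤ 2 := by
    intro i
    obtain ⟨v, hv, hl⟩ := hG i
    have := lintegral_exp_sq_div_gaussianReal_le hV hv
    rwa [← hl.map_eq, lintegral_map' (by fun_prop) hl.aemeasurable] at this
  have hmeas : ∀ i, AEMeasurable (fun ω => ENNReal.ofReal (Real.exp (G i ω ^ 2 / (4 * V)))) P := by
    intro i
    obtain ⟨v, hv, hl⟩ := hG i
    have := hl.aemeasurable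
    fun_prop
  calc ∫⁻ ω, ⨆ i, ENNReal.ofReal (G i ω ^ 2) ∂P
      ≤ ∫⁻ ω, (ENNReal.ofReal (4 * V * Real.log (2 * n)) +
        ENNReal.ofReal (4 * V / (2 * n)) *
          ∑ i, ENNReal.ofReal (Real.exp (G i ω ^ 2 / (4 * V)))) ∂P := lintegral_mono hpt
    _ = ENNReal.ofReal (4 * V * Real.log (2 * n)) + ENNReal.ofReal (4 * V / (2 * n)) *
          ∑ i, ∫⁻ ω, ENNReal.ofReal (Real.exp (G i ω ^ 2 / (4 * V))) ∂P := by
        rw [lintegral_add_left measurable_const, lintegral_const_mul' _ _ ENNReal.ofReal_ne_top,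
          lintegral_finsetSum' _ fun i _ => hmeas i]
        simp
    _ ≤ ENNReal.ofReal (4 * V * Real.log (2 * n)) + ENNReal.ofReal (4 * V / (2 * n)) *
          ENNReal.ofReal (2 * n) := by
        gcongr
        refine (Finset.sum_le_sum fun i _ => hexp i).trans (le_of_eq ?_)
        rw [Finset.sum_const, Finset.card_univ, nsmul_eq_mul, mul_comm,
          ENNReal.ofReal_mul (by norm_num), hn]
        simp
    _ = ENNReal.ofReal (4 * V * (Real.log (2 * n) + 1)) := by
        rw [← ENNReal.ofReal_mul (by positivity), ← ENNReal.ofReal_add (by positivity)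
          (by positivity)]
        congr 1
        field_simp

/-! ### Dyadic chaining -/

/-- The largest squared increment over `N * 2 ^ n` consecutive intervals of length `h / 2 ^ n`. -/
noncomputable def maxSqIncrement {d : ℕ} (w : ℝ≥0 → Fin d → ℝ) (h : ℝ≥0) (N n : ℕ) : ℝ≥0∞ :=
  ⨆ p : Fin d × Fin (N * 2 ^ n), ENNReal.ofReal
    ((w ((p.2 + 1 : ℕ) * (h / 2 ^ n)) p.1 - w ((p.2 : ℕ) * (h / 2 ^ n)) p.1) ^ 2)

/-- A bound for the squared oscillation of `w` over intervals of the grid of step `h`. -/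
noncomputable def sqOscBound {d : ℕ} (w : ℝ≥0 → Fin d → ℝ) (h : ℝ≥0) (N : ℕ) : ℝ≥0∞ :=
  ∑' n : ℕ, ENNReal.ofReal (4 * (4 / 3) ^ n) * maxSqIncrement w h N n

theorem ofReal_sq_increment_le {d : ℕ} (w : ℝ≥0 → Fin d → ℝ) (h : ℝ≥0) {N n k : ℕ}
    (hk : k < N * 2 ^ n) (i : Fin d) :
    ENNReal.ofReal ((w ((k + 1 : ℕ) * (h / 2 ^ n)) i - w (k * (h / 2 ^ n)) i) ^ 2) ≤
      maxSqIncrement w h N n :=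
  le_iSup (fun p : Fin d × Fin (N * 2 ^ n) => ENNReal.ofReal
    ((w ((p.2 + 1 : ℕ) * (h / 2 ^ n)) p.1 - w ((p.2 : ℕ) * (h / 2 ^ n)) p.1) ^ 2)) (i, ⟨k, hk⟩)

theorem ofReal_sq_grid_increment_le {d : ℕ} (w : ℝ≥0 → Fin d → ℝ) (h : ℝ≥0) {N k : ℕ}
    (hk : k < N) (i : Fin d) :
    ENNReal.ofReal ((w ((k + 1 : ℕ) * h) i - w (k * h) i) ^ 2) ≤ sqOscBound w h N := by
  refine le_trans ?_ (ENNReal.le_tsum 0)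
  have h1 := ofReal_sq_increment_le w h (n := 0) (N := N) (k := k) (by simpa using hk) i
  simp only [pow_zero, div_one, mul_one] at h1 ⊢
  refine h1.trans ?_
  nth_rw 1 [← one_mul (maxSqIncrement w h N 0)]
  gcongr
  simp

/-- The largest point of the grid of step `h / 2 ^ n` below `s`. -/
noncomputable def dyadicFloor (h s : ℝ≥0) (n : ℕ) : ℝ≥0 := ⌊s / (h / 2 ^ n)⌋₊ * (h / 2 ^ n)

theorem dyadicFloor_zero (h s : ℝ≥0) : dyadicFloor h s 0 = ⌊s / h⌋₊ * h := by
  simp [dyadicFloor]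

theorem tendsto_dyadicFloor {h : ℝ≥0} (hh : 0 < h) (s : ℝ≥0) :
    Filter.Tendsto (dyadicFloor h s) Filter.atTop (nhds s) := by
  rw [← NNReal.tendsto_coe]
  have hu : Filter.Tendsto (fun n : ℕ => (s : ℝ) - h * (1 / 2) ^ n) Filter.atTop (nhds s) := by
    have := ((tendsto_pow_atTop_nhds_zero_of_lt_one (r := (1 / 2 : ℝ)) (by norm_num)
      (by norm_num)).const_mul (h : ℝ)).const_sub (s : ℝ)
    simpa using this
  refine tendsto_of_tendsto_of_tendsto_of_le_of_le hu tendsto_const_nhds (fun n => ?_) fun n => ?_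
  · have hpos : 0 < h / 2 ^ n := by positivity
    have := (Nat.lt_floor_add_one (s / (h / 2 ^ n))).le
    rw [div_le_iff₀ hpos] at this
    have h2 : (s : ℝ) ≤ (⌊s / (h / 2 ^ n)⌋₊ + 1) * (h / 2 ^ n) := by exact_mod_cast this
    simp only [dyadicFloor]
    push_cast
    have h3 : (h : ℝ) * (1 / 2) ^ n = h / 2 ^ n := by rw [one_div, inv_pow, div_eq_mul_inv]
    rw [h3]
    linarith
  · have hpos : 0 < h / 2 ^ n := by positivity
    have := Nat.floor_le (zero_le (a := s / (h / 2 ^ n)))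
    rw [le_div_iff₀ hpos] at this
    exact NNReal.coe_le_coe.2 this

/-- Passing to the coarser level rounds the index `a` down to an even number, so the two floors are
equal or adjacent points of the finer grid. -/
theorem ofReal_sq_dyadicFloor_succ_le {d : ℕ} (w : ℝ≥0 → Fin d → ℝ) {h s : ℝ≥0} {N : ℕ}
    (hs : s < N * h) (n : ℕ) (i : Fin d) :
    ENNReal.ofReal ((w (dyadicFloor h s (n + 1)) i - w (dyadicFloor h s n) i) ^ 2) ≤
      maxSqIncrement w h N (n + 1) := by
  have hh : 0 < h := by
    rcases eq_zero_or_pos h with rfl | h0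
    · simp at hs
    · exact h0
  set e := h / 2 ^ (n + 1) with he
  have he0 : 0 < e := by positivity
  have hen : h / 2 ^ n = 2 * e := by rw [he, pow_succ]; field_simp
  set a := ⌊s / e⌋₊ with ha
  have hfl : ⌊s / (2 * e)⌋₊ = a / 2 := by
    rw [ha, ← Nat.floor_div_natCast]
    congr 1
    push_cast
    field_simp
  have e1 : dyadicFloor h s (n + 1) = a * e := rfl
  have e2 : dyadicFloor h s n = (2 * (a / 2) : ℕ) * e := by
    rw [dyadicFloor, hen, hfl]; push_cast; ring
  rcases Nat.mod_two_eq_zero_or_one a with h0 | h0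
  · have : 2 * (a / 2) = a := by omega
    rw [e1, e2, this]; simp
  · have h1 : a = 2 * (a / 2) + 1 := by omega
    have hlt : a < N * 2 ^ (n + 1) := by
      rw [ha, Nat.floor_lt zero_le, div_lt_iff₀ he0]
      refine hs.trans_le (le_of_eq ?_)
      rw [he]; push_cast; field_simp
    rw [e1, e2]
    have := ofReal_sq_increment_le w h (n := n + 1) (N := N) (k := 2 * (a / 2)) (by omega) i
    rwa [← h1] at this

/-- Telescope along the dyadic floors of `s`, apply a weighted Cauchy–Schwarz inequality, and pass
to the limit by continuity. -/
theorem ofReal_sq_sub_floor_le {d : ℕ} {w : ℝ≥0 → Fin d → ℝ} {i : Fin d}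
    (hw : Continuous fun s => w s i) {h s : ℝ≥0} {N : ℕ} (hs : s < N * h) :
    ENNReal.ofReal ((w s i - w (⌊s / h⌋₊ * h) i) ^ 2) ≤ sqOscBound w h N := by
  have hh : 0 < h := by
    rcases eq_zero_or_pos h with rfl | h0
    · simp at hs
    · exact h0
  rw [← dyadicFloor_zero]
  have hlim : Filter.Tendsto (fun n => ENNReal.ofReal
      ((w (dyadicFloor h s n) i - w (dyadicFloor h s 0) i) ^ 2)) Filter.atTop
      (nhds (ENNReal.ofReal ((w s i - w (dyadicFloor h s 0) i) ^ 2))) := by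
    refine ENNReal.tendsto_ofReal (Filter.Tendsto.pow (Filter.Tendsto.sub_const ?_ _) 2)
    exact (hw.tendsto s).comp (tendsto_dyadicFloor hh s)
  refine le_of_tendsto' hlim fun n => ?_
  set a : ℕ → ℝ := fun k => w (dyadicFloor h s (k + 1)) i - w (dyadicFloor h s k) i with ha
  -- The weights sum to at most `1`; their inverses `4 (4 / 3) ^ k` are the coefficients in
  -- `sqOscBound` and grow more slowly than `2 ^ k`.
  set g : ℕ → ℝ := fun k => 1 / 4 * (3 / 4) ^ k with hg
  have hg0 : ∀ k, 0 < g k := fun k => by positivity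
  have hsum : w (dyadicFloor h s n) i - w (dyadicFloor h s 0) i = ∑ k ∈ Finset.range n, a k :=
    (Finset.sum_range_sub (fun k => w (dyadicFloor h s k) i) n).symm
  have hgs : ∑ k ∈ Finset.range n, g k ≤ 1 := by
    rw [hg, ← Finset.mul_sum, geom_sum_eq (by norm_num)]
    have h1 : (0 : ℝ) ≤ (3 / 4) ^ n := by positivity
    have h2 : (1 / 4 : ℝ) * (((3 / 4) ^ n - 1) / (3 / 4 - 1)) = 1 - (3 / 4) ^ n := by ring
    linarith
  have hcs : (∑ k ∈ Finset.range n, a k) ^ 2 ≤ ∑ k ∈ Finset.range n, a k ^ 2 / g k := by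
    rcases Nat.eq_zero_or_pos n with rfl | hn
    · simp
    · have hpos : 0 < ∑ k ∈ Finset.range n, g k :=
        Finset.sum_pos (fun k _ => hg0 k) ⟨0, by simpa using hn⟩
      have h1 := Finset.sq_sum_div_le_sum_sq_div (Finset.range n) a (fun k _ => hg0 k)
      refine le_trans ?_ h1
      rw [le_div_iff₀ hpos]
      nlinarith [sq_nonneg (∑ k ∈ Finset.range n, a k)]
  rw [hsum]
  refine (ENNReal.ofReal_le_ofReal hcs).trans ?_
  rw [ENNReal.ofReal_sum_of_nonneg fun k _ => div_nonneg (sq_nonneg _) (hg0 k).le]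
  -- The step from level `k` to `k + 1` is charged to the term `k + 1`, wasting a harmless factor `4
  -- / 3`.
  have hterm : ∀ k, ENNReal.ofReal (a k ^ 2 / g k) ≤
      ENNReal.ofReal (4 * (4 / 3) ^ (k + 1)) * maxSqIncrement w h N (k + 1) := by
    intro k
    have h1 : a k ^ 2 / g k ≤ 4 * (4 / 3) ^ (k + 1) * a k ^ 2 := by
      have : (g k)⁻¹ = 4 * (4 / 3) ^ k := by
        rw [hg]; simp only; rw [mul_inv, ← inv_pow]; norm_num
      rw [div_eq_mul_inv, this, pow_succ (4 / 3 : ℝ) k]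
      have : 0 ≤ (4 / 3 : ℝ) ^ k * a k ^ 2 := by positivity
      linarith
    refine (ENNReal.ofReal_le_ofReal h1).trans ?_
    rw [ENNReal.ofReal_mul (by positivity)]
    gcongr
    exact ofReal_sq_dyadicFloor_succ_le w hs k i
  refine (Finset.sum_le_sum fun k _ => hterm k).trans ?_
  refine (ENNReal.sum_le_tsum (Finset.range n)).trans ?_
  exact ENNReal.tsum_comp_le_tsum_of_injective (add_left_injective 1)
    (fun k => ENNReal.ofReal (4 * (4 / 3) ^ k) * maxSqIncrement w h N k)

theorem lintegral_sqOscBound_le {Ω : Type*} [MeasurableSpace Ω] {P : Measure Ω}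
    [IsProbabilityMeasure P] {d : ℕ} (hd : 1 ≤ d) {W : ℝ≥0 → Ω → Fin d → ℝ} {b : ℝ} (hb : 0 < b)
    (hW : ∀ s u : ℝ≥0, s ≤ u → ∀ i, ∃ v : ℝ≥0, (v : ℝ) ≤ b * (u - s) ∧
      HasLaw (fun ω => W u ω i - W s ω i) (gaussianReal 0 v) P)
    {h : ℝ≥0} (hh : 0 < h) {N : ℕ} (hN : 1 ≤ N) :
    AEMeasurable (fun ω => sqOscBound (fun s => W s ω) h N) P ∧
    ∫⁻ ω, sqOscBound (fun s => W s ω) h N ∂P ≤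
      ENNReal.ofReal (48 * b * h * (Real.log d + Real.log N + 4)) := by
  have hd' : (1 : ℝ) ≤ d := by exact_mod_cast hd
  have hN' : (1 : ℝ) ≤ N := by exact_mod_cast hN
  have hld := Real.log_nonneg hd'
  have hlN := Real.log_nonneg hN'
  have hstep : ∀ (n : ℕ) (p : Fin d × Fin (N * 2 ^ n)), ∃ v : ℝ≥0, (v : ℝ) ≤ b * (h / 2 ^ n) ∧
      HasLaw (fun ω => W ((p.2 + 1 : ℕ) * (h / 2 ^ n)) ω p.1 - W ((p.2 : ℕ) * (h / 2 ^ n)) ω p.1)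
        (gaussianReal 0 v) P := by
    intro n p
    obtain ⟨v, hv, hl⟩ := hW ((p.2 : ℕ) * (h / 2 ^ n)) ((p.2 + 1 : ℕ) * (h / 2 ^ n))
      (by gcongr; omega) p.1
    refine ⟨v, hv.trans (le_of_eq ?_), hl⟩
    push_cast
    ring
  have hmeas : ∀ n, AEMeasurable (fun ω => maxSqIncrement (fun s => W s ω) h N n) P := by
    intro n
    refine AEMeasurable.iSup fun p => ?_
    obtain ⟨v, hv, hl⟩ := hstep n p
    exact (hl.aemeasurable.pow_const 2).ennreal_ofReal
  refine ⟨AEMeasurable.tsum fun n => (hmeas n).const_mul _, ?_⟩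
  have hn : ∀ n, ∫⁻ ω, maxSqIncrement (fun s => W s ω) h N n ∂P ≤ ENNReal.ofReal
      (4 * (b * (h / 2 ^ n)) * (Real.log d + Real.log N + 2 + n)) := by
    intro n
    have : Nonempty (Fin d × Fin (N * 2 ^ n)) :=
      ⟨(⟨0, hd⟩, ⟨0, by positivity⟩)⟩
    refine (lintegral_iSup_sq_gaussian_le (by positivity) (hstep n)).trans ?_
    apply ENNReal.ofReal_le_ofReal
    refine mul_le_mul_of_nonneg_left ?_ (by positivity)
    rw [Fintype.card_prod, Fintype.card_fin, Fintype.card_fin]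
    push_cast
    rw [Real.log_mul (by norm_num) (by positivity), Real.log_mul (by positivity) (by positivity),
      Real.log_mul (by positivity) (by positivity), Real.log_pow]
    have h2 : Real.log 2 ≤ 1 := by linarith [Real.log_two_lt_d9]
    nlinarith [Nat.cast_nonneg (α := ℝ) n]
  set c := Real.log d + Real.log N + 2 with hc
  have hc0 : 0 ≤ c := by positivity
  -- The ratio `2 / 3` is `(4 / 3) / 2`: inverse weight times decay of the variance.
  have hs1 : HasSum (fun n : ℕ => (2 / 3 : ℝ) ^ n) 3 := by
    have := hasSum_geometric_of_lt_one (r := (2 / 3 : ℝ)) (by norm_num) (by norm_num)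
    norm_num at this
    exact this
  have hs2 : HasSum (fun n : ℕ => (n : ℝ) * (2 / 3 : ℝ) ^ n) 6 := by
    have := hasSum_coe_mul_geometric_of_norm_lt_one (r := (2 / 3 : ℝ)) (by norm_num)
    norm_num at this
    exact this
  have hs : HasSum (fun n : ℕ => 4 * (4 / 3 : ℝ) ^ n * (4 * (b * (h / 2 ^ n)) * (c + n)))
      (16 * b * h * (c * 3 + 6)) := by
    have hf : (fun n : ℕ => 4 * (4 / 3 : ℝ) ^ n * (4 * (b * (h / 2 ^ n)) * (c + n))) =
        fun n : ℕ => 16 * b * h * (c * (2 / 3 : ℝ) ^ n + n * (2 / 3 : ℝ) ^ n) := by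
      funext n
      have h1 : (2 / 3 : ℝ) ^ n = (4 / 3) ^ n / 2 ^ n := by rw [← div_pow]; norm_num
      rw [h1]
      ring
    rw [hf]
    exact ((hs1.mul_left c).add hs2).mul_left (16 * b * h)
  unfold sqOscBound
  rw [lintegral_tsum fun n => (hmeas n).const_mul _]
  calc ∑' n, ∫⁻ ω, ENNReal.ofReal (4 * (4 / 3) ^ n) * maxSqIncrement (fun s => W s ω) h N n ∂P
      ≤ ∑' n : ℕ, ENNReal.ofReal (4 * (4 / 3 : ℝ) ^ n * (4 * (b * (h / 2 ^ n)) * (c + n))) := by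
        refine ENNReal.tsum_le_tsum fun n => ?_
        rw [lintegral_const_mul' _ _ ENNReal.ofReal_ne_top,
          ENNReal.ofReal_mul (p := 4 * (4 / 3 : ℝ) ^ n) (by positivity)]
        gcongr
        exact hn n
    _ = ENNReal.ofReal (16 * b * h * (c * 3 + 6)) := by
        rw [← hs.tsum_eq, ENNReal.ofReal_tsum_of_nonneg (fun n => by positivity) hs.summable]
    _ ≤ _ := by
        apply ENNReal.ofReal_le_ofReal
        rw [hc]
        apply le_of_eq
        ring

/-- Each coordinate is a sum of independent Gaussians, so its variance involves only the diagonal of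
`C Cᵀ`. Correlations between coordinates play no role, which keeps the constants free of `d`. -/
theorem hasLaw_mulVec_increment {Ω : Type*} [MeasurableSpace Ω] {P : Measure Ω}
    [IsProbabilityMeasure P] {d : ℕ} {B : ℝ≥0 → Ω → Fin d → ℝ} (hB : IsStandardBM B P)
    (C : Matrix (Fin d) (Fin d) ℝ) {b : ℝ} {i : Fin d} (hC : (C * Cᵀ) i i ≤ b) {s u : ℝ≥0}
    (hsu : s ≤ u) : ∃ v : ℝ≥0, (v : ℝ) ≤ b * (u - s) ∧
      HasLaw (fun ω => (C *ᵥ B u ω) i - (C *ᵥ B s ω) i) (gaussianReal 0 v) P := by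
  set X : Fin d → Ω → ℝ := fun j ω => C i j * (B u ω j - B s ω j) with hX
  have hlaw : ∀ j, HasLaw (fun ω => B u ω j - B s ω j)
      (gaussianReal 0 (nndist (u : ℝ) s)) P := fun j => (hB.brownian j).hasLaw_sub u s
  have hXlaw : ∀ j, HasLaw (X j) _ P := fun j => gaussianReal_const_mul (hlaw j) (C i j)
  have hXg : ∀ j, HasGaussianLaw (X j) P := fun j => (hXlaw j).hasGaussianLaw
  have hind : iIndepFun X P :=
    hB.indep.comp (fun j (f : ℝ≥0 → ℝ) => C i j * (f u - f s)) fun j => by fun_prop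
  have hsum := iIndepFun.hasGaussianLaw_sum hXg hind
  have heq : (fun ω => (C *ᵥ B u ω) i - (C *ᵥ B s ω) i) = ∑ j, X j := by
    ext ω
    simp only [Matrix.mulVec, dotProduct, Finset.sum_apply, hX, mul_sub, Finset.sum_sub_distrib]
  rw [heq]
  have hmean : ∫ ω, (∑ j, X j) ω ∂P = 0 := by
    simp only [Finset.sum_apply]
    rw [integral_finsetSum _ fun j _ => (hXg j).integrable]
    refine Finset.sum_eq_zero fun j _ => ?_
    rw [(hXlaw j).integral_eq, integral_id_gaussianReal, mul_zero]
  have hvar : Var[∑ j, X j; P] = (C * Cᵀ) i i * (u - s) := by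
    rw [IndepFun.variance_sum (fun j _ => (hXg j).memLp_two)
      (fun j _ k _ hjk => hind.indepFun hjk), Matrix.mul_apply, Finset.sum_mul]
    refine Finset.sum_congr rfl fun j _ => ?_
    rw [(hXlaw j).variance_eq, variance_id_gaussianReal]
    have : ((nndist (u : ℝ) s : ℝ≥0) : ℝ) = u - s := by
      rw [coe_nndist, Real.dist_eq, abs_of_nonneg (sub_nonneg.2 (NNReal.coe_le_coe.2 hsu))]
    simp [this, pow_two]
  refine ⟨Var[∑ j, X j; P].toNNReal, ?_, ⟨hsum.aemeasurable, ?_⟩⟩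
  · rw [Real.coe_toNNReal _ (variance_nonneg _ _), hvar]
    exact mul_le_mul_of_nonneg_right hC (sub_nonneg.2 (NNReal.coe_le_coe.2 hsu))
  · rw [hsum.map_eq_gaussianReal, hmean]

/-! ### Interpolation error -/

theorem gridBelow_eq {h : ℝ≥0} (hh : 0 < h) (s : ℝ≥0) : gridBelow h s = ⌊s / h⌋₊ * h := by
  refine IsGreatest.csSup_eq ⟨⟨⟨_, rfl⟩, ?_⟩, ?_⟩
  · exact (le_div_iff₀ hh).1 (Nat.floor_le zero_le)
  · rintro r ⟨⟨k, rfl⟩, hk⟩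
    gcongr
    exact Nat.le_floor ((le_div_iff₀ hh).2 hk)

theorem gridAbove_eq {h : ℝ≥0} (hh : 0 < h) (s : ℝ≥0) :
    gridAbove h s = (⌊s / h⌋₊ + 1 : ℕ) * h := by
  refine IsLeast.csInf_eq ⟨⟨⟨_, rfl⟩, ?_⟩, ?_⟩
  · rw [← div_lt_iff₀ hh]
    exact_mod_cast Nat.lt_floor_add_one (s / h)
  · rintro r ⟨⟨k, rfl⟩, hk⟩
    gcongr
    exact Nat.succ_le_of_lt ((Nat.floor_lt zero_le).2 ((div_lt_iff₀ hh).2 hk))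

theorem mulVec_interpolate_sub {d : ℕ} (C : Matrix (Fin d) (Fin d) ℝ) (b : ℝ≥0 → Fin d → ℝ)
    {h : ℝ≥0} (hh : 0 < h) (s : ℝ≥0) (i : Fin d) :
    (C *ᵥ interpolate h b s) i - (C *ᵥ b s) i =
      ((C *ᵥ b (⌊s / h⌋₊ * h)) i - (C *ᵥ b s) i) + (s / h - ⌊s / h⌋₊) *
        ((C *ᵥ b ((⌊s / h⌋₊ + 1 : ℕ) * h)) i - (C *ᵥ b (⌊s / h⌋₊ * h)) i) := by
  have hh' : (h : ℝ) ≠ 0 := by exact_mod_cast hh.ne'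
  have e : ((s : ℝ) - gridBelow h s) / ((gridAbove h s : ℝ) - gridBelow h s) =
      s / h - ⌊s / h⌋₊ := by
    rw [gridBelow_eq hh, gridAbove_eq hh]
    push_cast
    have : ((⌊s / h⌋₊ : ℝ) + 1) * h - ⌊s / h⌋₊ * h = h := by ring
    rw [this, sub_div, mul_div_cancel_right₀ _ hh']
  rw [interpolate, e, gridBelow_eq hh, gridAbove_eq hh, Matrix.mulVec_add, Matrix.mulVec_smul,
    Matrix.mulVec_sub]
  simp only [Pi.add_apply, Pi.smul_apply, Pi.sub_apply, smul_eq_mul]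
  ring

theorem floor_frac_mem {h : ℝ≥0} (s : ℝ≥0) :
    0 ≤ (s : ℝ) / h - ⌊s / h⌋₊ ∧ (s : ℝ) / h - ⌊s / h⌋₊ ≤ 1 := by
  have h1 : ((⌊s / h⌋₊ : ℝ≥0) : ℝ) ≤ (s / h : ℝ≥0) :=
    NNReal.coe_le_coe.2 (Nat.floor_le zero_le)
  have h2 : ((s / h : ℝ≥0) : ℝ) ≤ ((⌊s / h⌋₊ + 1 : ℝ≥0) : ℝ) :=
    NNReal.coe_le_coe.2 (Nat.lt_floor_add_one (s / h)).le
  push_cast at h1 h2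
  constructor <;> linarith

/-- Interpolation error up to a time that is at least one grid step. -/
theorem ofReal_sq_interpolate_sub_le {d : ℕ} (C : Matrix (Fin d) (Fin d) ℝ)
    {b : ℝ≥0 → Fin d → ℝ} (hb : ∀ i, Continuous fun s => b s i) {h : ℝ≥0} (hh : 0 < h)
    {s : ℝ≥0} {N : ℕ} (hs : s < N * h) (i : Fin d) :
    ENNReal.ofReal (((C *ᵥ interpolate h b s) i - (C *ᵥ b s) i) ^ 2) ≤
      4 * sqOscBound (fun s => C *ᵥ b s) h N := by
  have hcont : Continuous fun s => (C *ᵥ b s) i := by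
    simp only [Matrix.mulVec, dotProduct]
    fun_prop
  have h1 := ofReal_sq_sub_floor_le (w := fun s => C *ᵥ b s) hcont hs
  have hk : ⌊s / h⌋₊ < N := (Nat.floor_lt zero_le).2 ((div_lt_iff₀ hh).2 hs)
  have h2 := ofReal_sq_grid_increment_le (fun s => C *ᵥ b s) h hk i
  obtain ⟨f0, f1⟩ := floor_frac_mem (h := h) s
  rw [mulVec_interpolate_sub C b hh]
  set θ : ℝ := (s : ℝ) / h - ⌊s / h⌋₊
  set p := (C *ᵥ b s) i - (C *ᵥ b (⌊s / h⌋₊ * h)) i with hp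
  set q := (C *ᵥ b ((⌊s / h⌋₊ + 1 : ℕ) * h)) i - (C *ᵥ b (⌊s / h⌋₊ * h)) i
  have h3 : ((C *ᵥ b (⌊s / h⌋₊ * h)) i - (C *ᵥ b s) i + θ * q) ^ 2 ≤ 2 * p ^ 2 + 2 * q ^ 2 := by
    have : θ ^ 2 ≤ 1 := by nlinarith
    have : θ ^ 2 * q ^ 2 ≤ 1 * q ^ 2 := mul_le_mul_of_nonneg_right this (sq_nonneg q)
    have e : (C *ᵥ b (⌊s / h⌋₊ * h)) i - (C *ᵥ b s) i = -p := by rw [hp]; ring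
    rw [e]
    nlinarith [sq_nonneg (p + θ * q)]
  refine (ENNReal.ofReal_le_ofReal h3).trans ?_
  rw [ENNReal.ofReal_add (by positivity) (by positivity), ENNReal.ofReal_mul (by norm_num),
    ENNReal.ofReal_mul (by norm_num)]
  have h4 : ENNReal.ofReal 2 = 2 := by simp
  rw [h4]
  calc _ ≤ 2 * sqOscBound (fun s => C *ᵥ b s) h N + 2 * sqOscBound (fun s => C *ᵥ b s) h N := by
        gcongr
    _ = _ := by rw [← add_mul]; norm_num

/-- Interpolation error up to a time below the first grid step. -/
theorem ofReal_sq_interpolate_sub_le_of_lt {d : ℕ} (C : Matrix (Fin d) (Fin d) ℝ)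
    {b : ℝ≥0 → Fin d → ℝ} (hb : ∀ i, Continuous fun s => b s i) {h t s : ℝ≥0}
    (hst : s ≤ t) (ht : 0 < t) (hth : t < h) (i : Fin d) :
    ENNReal.ofReal (((C *ᵥ interpolate h b s) i - (C *ᵥ b s) i) ^ 2) ≤
      2 * sqOscBound (fun s => C *ᵥ b s) t 1 +
        ENNReal.ofReal (2 * (t / h) ^ 2) * sqOscBound (fun s => C *ᵥ b s) h 1 := by
  have hh : 0 < h := ht.trans hth
  have hh' : (0 : ℝ) < h := hh
  have hcont : Continuous fun s => (C *ᵥ b s) i := by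
    simp only [Matrix.mulVec, dotProduct]
    fun_prop
  have h1 : ENNReal.ofReal (((C *ᵥ b s) i - (C *ᵥ b 0) i) ^ 2) ≤
      sqOscBound (fun s => C *ᵥ b s) t 1 := by
    -- At `s = t` the floor of `s / t` is `1`, so the endpoint is a full grid increment instead.
    rcases hst.eq_or_lt with rfl | hlt
    · simpa using ofReal_sq_grid_increment_le (fun s => C *ᵥ b s) s (N := 1) (k := 0) one_pos i
    · have h0 : ⌊s / t⌋₊ = 0 := Nat.floor_eq_zero.2 ((div_lt_one ht).2 hlt)
      have := ofReal_sq_sub_floor_le (w := fun s => C *ᵥ b s) hcont (h := t) (s := s) (N := 1)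
        (by simpa using hlt)
      simpa [h0] using this
  have h2 : ENNReal.ofReal (((C *ᵥ b h) i - (C *ᵥ b 0) i) ^ 2) ≤
      sqOscBound (fun s => C *ᵥ b s) h 1 := by
    simpa using ofReal_sq_grid_increment_le (fun s => C *ᵥ b s) h (N := 1) (k := 0) one_pos i
  have h0 : ⌊s / h⌋₊ = 0 := Nat.floor_eq_zero.2 ((div_lt_one hh).2 (hst.trans_lt hth))
  rw [mulVec_interpolate_sub C b hh, h0]
  simp only [Nat.cast_zero, zero_mul, sub_zero, zero_add, Nat.cast_one, one_mul]
  set p := (C *ᵥ b s) i - (C *ᵥ b 0) i with hp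
  set q := (C *ᵥ b h) i - (C *ᵥ b 0) i
  have h3 : ((C *ᵥ b 0) i - (C *ᵥ b s) i + (s : ℝ) / h * q) ^ 2 ≤
      2 * p ^ 2 + 2 * ((t : ℝ) / h) ^ 2 * q ^ 2 := by
    have hsh : (s : ℝ) / h ≤ t / h := by gcongr
    have : ((s : ℝ) / h) ^ 2 * q ^ 2 ≤ ((t : ℝ) / h) ^ 2 * q ^ 2 := by gcongr
    have e : (C *ᵥ b 0) i - (C *ᵥ b s) i = -p := by rw [hp]; ring
    rw [e]
    nlinarith [sq_nonneg (p + (s : ℝ) / h * q)]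
  refine (ENNReal.ofReal_le_ofReal h3).trans ?_
  rw [ENNReal.ofReal_add (by positivity) (by positivity),
    ENNReal.ofReal_mul (p := 2) (q := p ^ 2) (by norm_num),
    ENNReal.ofReal_mul (p := 2 * ((t : ℝ) / h) ^ 2) (q := q ^ 2) (by positivity)]
  have h4 : ENNReal.ofReal 2 = 2 := by simp
  rw [h4]
  gcongr

/-- A dominating `Z` avoids the measurability of a supremum over `s`. If `t < h`, then `L` can be
much smaller than `log d`, and the estimate survives only through the factor `r = t / h`, since `r
log (1 / r) ≤ 1`. -/
theorem exists_interpolate_error_bound {Ω : Type*} [MeasurableSpace Ω] {P : Measure Ω}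
    [IsProbabilityMeasure P] {d : ℕ} (hd : 1 ≤ d) {B : ℝ≥0 → Ω → Fin d → ℝ}
    (hB : IsStandardBM B P) {C : Matrix (Fin d) (Fin d) ℝ} {b : ℝ} (hb : 0 < b)
    (hC : ∀ i, (C * Cᵀ) i i ≤ b) {h t : ℝ≥0} (hh : 0 < h) (ht : 0 < t) {η L : ℝ} (hη : 0 < η)
    (hηL : η ≤ L) (hL : L = Real.log t + Real.log d - Real.log h) :
    ∃ Z : Ω → ℝ≥0∞,
      (∀ᵐ ω ∂P, ∀ s ≤ t, ∀ i, ENNReal.ofReal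
        (((C *ᵥ interpolate h (fun u => B u ω) s) i - (C *ᵥ B s ω) i) ^ 2) ≤ Z ω) ∧
      ∫⁻ ω, Z ω ∂P ≤ ENNReal.ofReal (192 * b * h * ((1 + 5 / η) * L)) := by
  have hL0 : 0 < L := hη.trans_le hηL
  -- Both cases end with a bound by `L + 5`; here `L ≥ η` absorbs the `5`.
  have h5 : L + 5 ≤ (1 + 5 / η) * L := by
    have : 1 ≤ L / η := (one_le_div hη).2 hηL
    have : 5 / η * L = 5 * (L / η) := by ring
    nlinarith
  have hh' : (0 : ℝ) < h := hh
  have ht' : (0 : ℝ) < t := ht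
  have hcont : ∀ᵐ ω ∂P, ∀ i, Continuous fun s => B s ω i :=
    ae_all_iff.2 fun i => (hB.brownian i).cont
  have hosc := fun (h : ℝ≥0) (hh : 0 < h) (N : ℕ) (hN : 1 ≤ N) =>
    lintegral_sqOscBound_le (P := P) hd (W := fun s ω => C *ᵥ B s ω) hb
      (fun s u hsu i => hasLaw_mulVec_increment hB C (hC i) hsu) hh hN
  rcases le_or_gt h t with hht | hth
  -- The extra cell makes `t < N * h` strict; as `t / h ≥ 1`, it costs at most a factor `2` in `N`.
  · set N := ⌊t / h⌋₊ + 1 with hN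
    refine ⟨fun ω => 4 * sqOscBound (fun s => C *ᵥ B s ω) h N, ?_, ?_⟩
    · filter_upwards [hcont] with ω hω s hs i
      refine ofReal_sq_interpolate_sub_le C hω hh (hs.trans_lt ?_) i
      rw [← div_lt_iff₀ hh, hN]
      exact_mod_cast Nat.lt_floor_add_one (t / h)
    · rw [lintegral_const_mul' _ _ (by norm_num)]
      calc 4 * ∫⁻ ω, sqOscBound (fun s => C *ᵥ B s ω) h N ∂P
          ≤ 4 * ENNReal.ofReal (48 * b * h * (Real.log d + Real.log N + 4)) := by
            gcongr; exact (hosc h hh N (by omega)).2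
        _ = ENNReal.ofReal (4 * (48 * b * h * (Real.log d + Real.log N + 4))) := by
            rw [ENNReal.ofReal_mul (p := 4) (by norm_num)]; simp
        _ ≤ _ := by
            apply ENNReal.ofReal_le_ofReal
            have hNle : (N : ℝ) ≤ 2 * (t / h) := by
              have h1 : (1 : ℝ) ≤ t / h := (one_le_div hh').2 hht
              have h2 : ((⌊t / h⌋₊ : ℝ≥0) : ℝ) ≤ (t / h : ℝ≥0) :=
                NNReal.coe_le_coe.2 (Nat.floor_le zero_le)
              push_cast at h2
              rw [hN]; push_cast; linarith
            have hlog : Real.log N ≤ 1 + (Real.log t - Real.log h) := by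
              have := Real.log_le_log (by positivity) hNle
              rw [Real.log_mul (by norm_num) (by positivity), Real.log_div ht'.ne' hh'.ne'] at this
              linarith [Real.log_two_lt_d9]
            have : Real.log d + Real.log N + 4 ≤ (1 + 5 / η) * L := by linarith
            have := mul_le_mul_of_nonneg_left this (by positivity : 0 ≤ 192 * b * (h : ℝ))
            linarith
  · refine ⟨fun ω => 2 * sqOscBound (fun s => C *ᵥ B s ω) t 1 +
        ENNReal.ofReal (2 * (t / h) ^ 2) * sqOscBound (fun s => C *ᵥ B s ω) h 1, ?_, ?_⟩
    · filter_upwards [hcont] with ω hω s hs i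
      exact ofReal_sq_interpolate_sub_le_of_lt C hω hs ht hth i
    · have hld : 0 ≤ Real.log d := Real.log_natCast_nonneg d
      rw [lintegral_add_left' ((hosc t ht 1 le_rfl).1.const_mul _),
        lintegral_const_mul' _ _ (by norm_num), lintegral_const_mul' _ _ ENNReal.ofReal_ne_top]
      calc _ ≤ 2 * ENNReal.ofReal (48 * b * t * (Real.log d + Real.log (1 : ℕ) + 4)) +
            ENNReal.ofReal (2 * (t / h) ^ 2) *
              ENNReal.ofReal (48 * b * h * (Real.log d + Real.log (1 : ℕ) + 4)) := by
            gcongr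
            · exact (hosc t ht 1 le_rfl).2
            · exact (hosc h hh 1 le_rfl).2
        _ = ENNReal.ofReal (2 * (48 * b * t * (Real.log d + Real.log (1 : ℕ) + 4)) +
              2 * (t / h) ^ 2 * (48 * b * h * (Real.log d + Real.log (1 : ℕ) + 4))) := by
            rw [Nat.cast_one, Real.log_one, ENNReal.ofReal_add (by positivity) (by positivity),
              ENNReal.ofReal_mul (p := 2) (by norm_num),
              ENNReal.ofReal_mul (p := 2 * ((t : ℝ) / h) ^ 2) (by positivity)]
            simp
        _ ≤ _ := by
            apply ENNReal.ofReal_le_ofReal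
            rw [Nat.cast_one, Real.log_one, add_zero]
            set r : ℝ := t / h with hr
            have htr : (t : ℝ) = r * h := by rw [hr]; field_simp
            have hr0 : 0 < r := by positivity
            have hr1 : r < 1 := (div_lt_one hh').2 hth
            have hlr : Real.log r = Real.log t - Real.log h := Real.log_div ht'.ne' hh'.ne'
            have hA : r * (Real.log d + 4) ≤ (1 + 5 / η) * L := by
              refine le_trans ?_ h5
              have h1 : Real.log r⁻¹ ≤ r⁻¹ - 1 := Real.log_le_sub_one_of_pos (by positivity)
              rw [Real.log_inv] at h1
              have h2 : r * -Real.log r ≤ 1 := by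
                have := mul_le_mul_of_nonneg_left h1 hr0.le
                rw [mul_sub, mul_inv_cancel₀ hr0.ne'] at this
                linarith
              have h3 : Real.log d = L - Real.log r := by linarith
              rw [h3]
              nlinarith
            have hB : r ^ 2 * (Real.log d + 4) ≤ r * (Real.log d + 4) := by
              apply mul_le_mul_of_nonneg_right _ (by positivity)
              nlinarith
            rw [htr]
            -- The terms of orders `r` and `r ^ 2` come from the oscillation on `[0, t]` and from
            -- the slope of the interpolant; each uses half of `192`.
            have e := mul_le_mul_of_nonneg_left (add_le_add hA (hB.trans hA))
              (by positivity : 0 ≤ 96 * b * (h : ℝ))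
            linarith

end RBM

/-! ### Mean-square error of the reflected processes -/

theorem mainTheorem5 (κ₀ β₀ b₀ η : ℝ) (hκ₀ : 0 < κ₀) (hβ₀ : β₀ ∈ Set.Ioo (0 : ℝ) 1)
    (hb₀ : 0 < b₀) (hη : 0 < η) :
    ∃ C₁ : ℝ, 0 < C₁ ∧
      ∀ (d : ℕ) (_ : 1 ≤ d) (δ₀ : ℝ) (_ : 0 < δ₀) (μ : Fin d → ℝ)
        (C Q : Matrix (Fin d) (Fin d) ℝ) (_ : RBM.UniformAssumptions κ₀ β₀ δ₀ b₀ μ C Q)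
        (Ω : Type*) [MeasurableSpace Ω] (P : Measure Ω) [IsProbabilityMeasure P]
        (B : ℝ≥0 → Ω → Fin d → ℝ) (_ : RBM.IsStandardBM B P)
        (γ : ℝ≥0) (_ : 0 < γ) (_ : γ < 1) (m : ℕ)
        (Y Ym : ℝ≥0 → Ω → Fin d → ℝ)
        (_ : RBM.IsReflectedProcess P (RBM.reflectionMatrix Q)
          (fun s ω => RBM.drivingPath μ C (fun u => B u ω) s) Y)
        (_ : RBM.IsReflectedProcess P (RBM.reflectionMatrix Q)
          (fun s ω => RBM.drivingPath μ C (RBM.interpolate (γ ^ m) (fun u => B u ω)) s) Ym)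
        (_ : ∀ᵐ ω ∂P, Ym 0 ω = Y 0 ω)
        (t : ℝ≥0) (_ : 0 < t)
        (_ : η ≤ Real.log t + Real.log d + m * Real.log (1 / γ)),
        Integrable (fun ω => ‖Ym t ω - Y t ω‖ ^ 2) P ∧
          ∫ ω, ‖Ym t ω - Y t ω‖ ^ 2 ∂P ≤
            C₁ * (γ : ℝ) ^ m * (Real.log t + Real.log d + m * Real.log (1 / γ)) := by
  set K : ℝ := 1 + (1 + κ₀) * (κ₀ / β₀) with hK
  have hβpos : 0 < β₀ := hβ₀.1
  have hK0 : 0 < K := by positivity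
  refine ⟨K ^ 2 * (192 * b₀ * (1 + 5 / η)), by positivity, ?_⟩
  intro d hd δ₀ hδ₀ μ C Q hU Ω _ P _ B hB γ hγ hγ1 m Y Ym hY hYm h0 t ht hL
  have hh : 0 < γ ^ m := pow_pos hγ m
  set L := Real.log t + Real.log d + m * Real.log (1 / γ) with hLdef
  have hLeq : L = Real.log t + Real.log d - Real.log (γ ^ m : ℝ≥0) := by
    rw [hLdef, one_div, Real.log_inv, NNReal.coe_pow, Real.log_pow]
    ring
  have hL0 : 0 < L := hη.trans_le hL
  obtain ⟨Z, hZ, hZi⟩ := RBM.exists_interpolate_error_bound hd hB hb₀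
    (fun i => (hU.variability i).2) hh ht hη hL hLeq
  have hpt : ∀ᵐ ω ∂P, ENNReal.ofReal (‖Ym t ω - Y t ω‖ ^ 2) ≤ ENNReal.ofReal (K ^ 2) * Z ω := by
    filter_upwards [hZ, hY.solves, hYm.solves, h0] with ω hω hs hsm h00
    obtain ⟨l, hl⟩ := hs
    obtain ⟨lm, hlm⟩ := hsm
    -- `Z` may be infinite at some sample points, where the bound is trivial; elsewhere its square
    -- root is a real uniform bound for the input error.
    by_cases hZt : Z ω = ⊤
    · rw [hZt, ENNReal.mul_top (by simpa using hK0.ne')]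
      exact le_top
    have hx : ∀ s ≤ t, ∀ i, |RBM.drivingPath μ C (RBM.interpolate (γ ^ m) fun u => B u ω) s i -
        RBM.drivingPath μ C (fun u => B u ω) s i| ≤ √(Z ω).toReal := by
      intro s hs i
      simp only [RBM.drivingPath, Pi.add_apply, add_sub_add_left_eq_sub]
      refine Real.abs_le_sqrt ?_
      exact (ENNReal.ofReal_le_iff_le_toReal hZt).1 (hω s hs i)
    have hlip := RBM.abs_reflected_sub_le hβ₀ hκ₀ hU.Q_nonneg hU.contraction hlm hl h00
      (Real.sqrt_nonneg _) hx
    have hnorm : ‖Ym t ω - Y t ω‖ ≤ K * √(Z ω).toReal :=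
      (pi_norm_le_iff_of_nonneg (by positivity)).2 hlip
    have hsq : ‖Ym t ω - Y t ω‖ ^ 2 ≤ K ^ 2 * (Z ω).toReal := by
      calc ‖Ym t ω - Y t ω‖ ^ 2 ≤ (K * √(Z ω).toReal) ^ 2 := by gcongr
        _ = K ^ 2 * (Z ω).toReal := by rw [mul_pow, Real.sq_sqrt ENNReal.toReal_nonneg]
    refine (ENNReal.ofReal_le_ofReal hsq).trans ?_
    rw [ENNReal.ofReal_mul (by positivity), ENNReal.ofReal_toReal hZt]
  have hbound : ∫⁻ ω, ENNReal.ofReal (‖Ym t ω - Y t ω‖ ^ 2) ∂P ≤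
      ENNReal.ofReal (K ^ 2 * (192 * b₀ * (1 + 5 / η)) * (γ : ℝ) ^ m * L) := by
    refine (lintegral_mono_ae hpt).trans ?_
    rw [lintegral_const_mul' _ _ ENNReal.ofReal_ne_top]
    refine (mul_le_mul_right hZi _).trans (le_of_eq ?_)
    rw [← ENNReal.ofReal_mul (by positivity)]
    congr 1
    push_cast
    ring
  have hmeas : AEStronglyMeasurable (fun ω => ‖Ym t ω - Y t ω‖ ^ 2) P :=
    (((hYm.aemeasurable t).sub (hY.aemeasurable t)).norm.pow_const 2).aestronglyMeasurable
  have hnn : 0 ≤ᵐ[P] fun ω => ‖Ym t ω - Y t ω‖ ^ 2 :=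
    Filter.Eventually.of_forall fun ω => sq_nonneg _
  refine ⟨⟨hmeas, ?_⟩, ?_⟩
  · rw [hasFiniteIntegral_iff_ofReal hnn]
    exact hbound.trans_lt ENNReal.ofReal_lt_top
  · rw [integral_eq_lintegral_of_nonneg_ae hnn hmeas]
    exact ENNReal.toReal_le_of_le_ofReal (by positivity) hbound
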